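/- **Setting.** Let $0<A_1<A_2$ and let $u_0\in C^2(\mathbb R)$ be real valued with $u_0(x)\to A_1$ as $x\to-\infty$, $u_0(x)\to A_2$ as $x\to+\infty$, and such that $m_0:=u_0-u_0''$ satisfies $m_0>0$, $m_0-A_1\in L^1(-\infty,0)$ and $m_0-A_2\in L^1(0,\infty)$. For $j=1,2$ put $$\dot\Sigma_j=\{\lambda\in\mathbb R:|\lambda|>1/A_j\},\qquad \dot\Sigma_0=\{\lambda\in\mathbb R: 1/A_2<|\lambda|<1/A_1\},\qquad \dot\Gamma_2=(-1/A_2,1/A_2),$$ and let $l_j(\lambda)=\sqrt{\lambda^2-A_j^{-2}}$ be the branch with cut $[-1/A_j,1/A_j]$ and $l_j(\lambda)\sim\lambda$ at infinity; on the cut $l_j$ denotes below the boundary value $l_j(\lambda_+)$ from the upper half-plane. **Reflection coefficient.** Let $$U=\frac12\begin{pmatrix}-1&\lambda m_0(x)\\-\lambda m_0(x)&1\end{pmatrix},\qquad H_j=\sqrt{\tfrac12}\,\sqrt{\tfrac1{\mathrm i A_jl_j}-1}\begin{pmatrix}\frac{\lambda A_j}{1-\mathrm i A_jl_j}&-1\\-1&\frac{\lambda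 A_j}{1-\mathrm iA_jl_j}\end{pmatrix}$$ (second root with cut $[0,\infty)$ and $\sqrt{-1}=\mathrm i$) and $f_j(x)=\mathrm iA_jl_j(\lambda)\big(\frac1{2A_j}\int_{(-1)^j\infty}^x(m_0-A_j)\,d\xi+\frac x2\big)$. For $\lambda\in\dot\Sigma_1\cup\dot\Sigma_0$ let $\Psi_1^{(1)},\Psi_2^{(1)},\Psi_2^{(2)}$ be the $\mathbb C^2$-valued solutions of $\psi_x=U\psi$ with $$e^{f_1}H_1\Psi_1^{(1)}\to\binom10\ (x\to-\infty),\qquad e^{f_2}H_2\Psi_2^{(1)}\to\binom10,\quad e^{-f_2}H_2\Psi_2^{(2)}\to\binom01\ (x\to+\infty),$$ write $\Psi_1^{(1)}=c_{11}\Psi_2^{(1)}+c_{21}\Psi_2^{(2)}$, and let $r(\lambda)=c_{21}(\lambda)/c_{11}(\lambda)$. **Jump matrix.** For $y\in\mathbb R$ and $t>0$ let $\hat f_2(\lambda)=\frac{\mathrm iA_2l_2(\lambda)}2\big(y-\frac{2t}{\lambda^2}\big)$. Let $\hat G(\lambda)=\begin{pmatrix}0&-\mathrm i\\-\mathrm i&0\end{pmatrix}$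 on $\dot\Gamma_2$, and on $\dot\Sigma_1\cup\dot\Sigma_0$ let $$\hat G(\lambda)=\begin{pmatrix}e^{-\hat f_2}&0\\0&e^{\hat f_2}\end{pmatrix}G_0(\lambda)\begin{pmatrix}e^{\hat f_2}&0\\0&e^{-\hat f_2}\end{pmatrix},$$ where $$G_0=\begin{pmatrix}1-|r|^2&-\bar r\\r&1\end{pmatrix}\text{ on }\dot\Sigma_1,\qquad G_0=\begin{pmatrix}0&-1/r\\r&1\end{pmatrix}\text{ on }\dot\Sigma_0.$$ **Proposition (vanishing lemma).** Let $y\in\mathbb R$, $t>0$, and let $m:\mathbb C\setminus\mathbb R\to\mathbb C^{2\times2}$ be analytic and such that * at every $\lambda\in\mathbb R\setminus\{\pm1/A_1,\pm1/A_2\}$ the limits $m_\pm(\lambda)$ of $m$ from the open upper and lower half-planes exist, and $m_+(\lambda)=m_-(\lambda)\hat G(\lambda)$; * $m(\lambda)=O(1/\lambda)$ as $\lambda\to\infty$ in $\mathbb C\setminus\mathbb R$; * $m(\lambda)=O(|\lambda-s|^{-1/4})$ as $\lambda\to s$ in $\mathbb C\setminus\mathbb R$, for each $s\in\{\pm1/A_1,\pm1/A_2\}$.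 Then $m\equiv0$. -/

import Mathlib

/-! Step-like modified Camassa-Holm problem: the reflection coefficient of the initial profile,
the jump matrix of the right Riemann-Hilbert problem, and its homogeneous version. -/

namespace StepMCH

open Filter Topology MeasureTheory Asymptotics

noncomputable section

/-- The open half-lines `(-∞, -1/A) ∪ (1/A, ∞)`. -/
def sigmaDot (A : ℝ) : Set ℝ := {lam | 1 / A < |lam|}

/-- The open intervals `(-1/A₁, -1/A₂) ∪ (1/A₂, 1/A₁)`. -/
def sigmaZeroDot (A₁ A₂ : ℝ) : Set ℝ := {lam | 1 / A₂ < |lam| ∧ |lam| < 1 / A₁}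

/-- The open segment `(-1/A, 1/A)`. -/
def gammaDot (A : ℝ) : Set ℝ := {lam | |lam| < 1 / A}

/-- The root `l(z) = √(z² - 1/A²)` with branch cut `[-1/A, 1/A]` and `l(z) ~ z` at infinity.
It is written as a product of two principal roots (argument in `(-π, π]`); the two cuts cancel on
`(-∞, -1/A)`.  At a real point `z` of the cut the formula gives the boundary value `l(z₊)` from the
upper half plane. -/
def rootL (A : ℝ) (z : ℂ) : ℂ :=
  (z - ((1 / A : ℝ) : ℂ)) ^ (1 / 2 : ℂ) * (z + ((1 / A : ℝ) : ℂ)) ^ (1 / 2 : ℂ)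

/-- The square root with branch cut `[0, ∞)` and `√(-1) = i`. -/
def sqrtCut (z : ℂ) : ℂ := Complex.I * (-z) ^ (1 / 2 : ℂ)

/-- The momentum `u₀ - u₀''`. -/
def momentum (u₀ : ℝ → ℝ) (x : ℝ) : ℝ := u₀ x - deriv (deriv u₀) x

/-- The coefficient matrix of the `x`-equation of the Lax pair, for momentum value `μ`. -/
def laxU (μ : ℝ) (z : ℂ) : Matrix (Fin 2) (Fin 2) ℂ :=
  (1 / 2 : ℂ) • !![-1, z * μ; -(z * μ), 1]

/-- `ψ` is a (column) solution of the `x`-equation `ψ' = U ψ` of the Lax pair. -/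
def IsLaxSolution (m₀ : ℝ → ℝ) (z : ℂ) (ψ : ℝ → Fin 2 → ℂ) : Prop :=
  ∀ x : ℝ, HasDerivAt ψ ((laxU (m₀ x) z).mulVec (ψ x)) x

/-- The gauge matrix `H` attached to the background `A`. -/
def gaugeH (A : ℝ) (z : ℂ) : Matrix (Fin 2) (Fin 2) ℂ :=
  (((Real.sqrt (1 / 2) : ℝ) : ℂ) * sqrtCut (1 / (Complex.I * A * rootL A z) - 1)) •
    !![z * A / (1 - Complex.I * A * rootL A z), -1;
       -1, z * A / (1 - Complex.I * A * rootL A z)]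

/-- The phase at time `0` normalized at `-∞`:
`i A l(z) ((1/(2A)) ∫_{-∞}^x (m₀ - A) + x/2)`. -/
def phaseLeft (A : ℝ) (m₀ : ℝ → ℝ) (x : ℝ) (z : ℂ) : ℂ :=
  Complex.I * A * rootL A z *
    ((1 / (2 * A) * (∫ ξ in Set.Iic x, (m₀ ξ - A)) + x / 2 : ℝ) : ℂ)

/-- The phase at time `0` normalized at `+∞`:
`i A l(z) ((1/(2A)) ∫_{+∞}^x (m₀ - A) + x/2)`. -/
def phaseRight (A : ℝ) (m₀ : ℝ → ℝ) (x : ℝ) (z : ℂ) : ℂ :=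
  Complex.I * A * rootL A z *
    ((1 / (2 * A) * (-∫ ξ in Set.Ioi x, (m₀ ξ - A)) + x / 2 : ℝ) : ℂ)

/-- First column of the left Jost solution: `e^{f₁} H₁ ψ → (1, 0)ᵀ` as `x → -∞`. -/
def IsJostLeftFst (A : ℝ) (m₀ : ℝ → ℝ) (z : ℂ) (ψ : ℝ → Fin 2 → ℂ) : Prop :=
  IsLaxSolution m₀ z ψ ∧
    Tendsto (fun x => Complex.exp (phaseLeft A m₀ x z) • (gaugeH A z).mulVec (ψ x))
      atBot (𝓝 ![1, 0])

/-- First column of the right Jost solution: `e^{f₂} H₂ ψ → (1, 0)ᵀ` as `x → +∞`. -/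
def IsJostRightFst (A : ℝ) (m₀ : ℝ → ℝ) (z : ℂ) (ψ : ℝ → Fin 2 → ℂ) : Prop :=
  IsLaxSolution m₀ z ψ ∧
    Tendsto (fun x => Complex.exp (phaseRight A m₀ x z) • (gaugeH A z).mulVec (ψ x))
      atTop (𝓝 ![1, 0])

/-- Second column of the right Jost solution: `e^{-f₂} H₂ ψ → (0, 1)ᵀ` as `x → +∞`. -/
def IsJostRightSnd (A : ℝ) (m₀ : ℝ → ℝ) (z : ℂ) (ψ : ℝ → Fin 2 → ℂ) : Prop :=
  IsLaxSolution m₀ z ψ ∧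
    Tendsto (fun x => Complex.exp (-phaseRight A m₀ x z) • (gaugeH A z).mulVec (ψ x))
      atTop (𝓝 ![0, 1])

/-- Step-like initial profile with the two backgrounds `A₁` (at `-∞`) and `A₂` (at `+∞`) and
positive momentum. -/
structure IsStepLike (A₁ A₂ : ℝ) (u₀ : ℝ → ℝ) : Prop where
  smooth : ContDiff ℝ 2 u₀
  momentum_pos : ∀ x, 0 < momentum u₀ x
  tendsto_left : Tendsto u₀ atBot (𝓝 A₁)
  tendsto_right : Tendsto u₀ atTop (𝓝 A₂)
  integrable_left : IntegrableOn (fun x => momentum u₀ x - A₁) (Set.Iic 0)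
  integrable_right : IntegrableOn (fun x => momentum u₀ x - A₂) (Set.Ici 0)

/-- `r` is the (right) reflection coefficient of `u₀`: on `Σ̇₁ ∪ Σ̇₀`, `r = c₂₁ / c₁₁`, where
`Ψ₁⁽¹⁾ = c₁₁ Ψ₂⁽¹⁾ + c₂₁ Ψ₂⁽²⁾`; on `Σ̇₀` the left Jost solution is taken on the upper side. -/
def IsReflectionCoefficient (A₁ A₂ : ℝ) (u₀ : ℝ → ℝ) (r : ℝ → ℂ) : Prop :=
  ∀ lam ∈ sigmaDot A₁ ∪ sigmaZeroDot A₁ A₂,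
    ∃ (ψ φ₁ φ₂ : ℝ → Fin 2 → ℂ) (c₁₁ c₂₁ : ℂ),
      IsJostLeftFst A₁ (momentum u₀) lam ψ ∧
      IsJostRightFst A₂ (momentum u₀) lam φ₁ ∧
      IsJostRightSnd A₂ (momentum u₀) lam φ₂ ∧
      (∀ x, ψ x = c₁₁ • φ₁ x + c₂₁ • φ₂ x) ∧
      r lam = c₂₁ / c₁₁

/-- The phase `f̂₂(y,t,z) = (i A₂ l₂(z) / 2) (y - 2t/z²)`. -/
def phaseHat (A₂ y t : ℝ) (z : ℂ) : ℂ :=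
  Complex.I * A₂ * rootL A₂ z / 2 * (y - 2 * t / z ^ 2)

open Classical in
/-- The matrix `G₀` on `Σ̇₁` and on `Σ̇₀`. -/
def jumpCore (A₁ : ℝ) (r : ℝ → ℂ) (lam : ℝ) : Matrix (Fin 2) (Fin 2) ℂ :=
  if lam ∈ sigmaDot A₁ then
    !![1 - ((‖r lam‖ ^ 2 : ℝ) : ℂ), -(starRingEnd ℂ) (r lam); r lam, 1]
  else
    !![0, -(1 / r lam); r lam, 1]

open Classical in
/-- The jump matrix `Ĝ(y,t,λ)`, `λ ∈ ℝ ∖ {±1/A₁, ±1/A₂}`: `-i σ₁` on `Γ̇₂` and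
`diag(e^{-f̂₂}, e^{f̂₂}) G₀ diag(e^{f̂₂}, e^{-f̂₂})` on `Σ̇₁ ∪ Σ̇₀`. -/
def jumpMatrix (A₁ A₂ : ℝ) (r : ℝ → ℂ) (y t lam : ℝ) : Matrix (Fin 2) (Fin 2) ℂ :=
  if lam ∈ gammaDot A₂ then
    !![0, -Complex.I; -Complex.I, 0]
  else
    !![Complex.exp (-phaseHat A₂ y t lam), 0; 0, Complex.exp (phaseHat A₂ y t lam)] *
      jumpCore A₁ r lam *
      !![Complex.exp (phaseHat A₂ y t lam), 0; 0, Complex.exp (-phaseHat A₂ y t lam)]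

/-- The complement of the real line. -/
def offReal : Set ℂ := {z | z.im ≠ 0}

/-- The exceptional points `±1/A₁, ±1/A₂` of the contour. -/
def branchPoints (A₁ A₂ : ℝ) : Set ℝ := {1 / A₁, -(1 / A₁), 1 / A₂, -(1 / A₂)}

/-- `m` solves the homogeneous right Riemann-Hilbert problem (no poles) with parameters `y, t`.
Only the values of `m` off the real line matter; the boundary values in `jump` are the limits
from the open upper and lower half planes. -/
structure IsHomogeneousSolution (A₁ A₂ : ℝ) (r : ℝ → ℂ) (y t : ℝ)
    (m : ℂ → Matrix (Fin 2) (Fin 2) ℂ) : Prop where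
  analytic : ∀ i j, DifferentiableOn ℂ (fun z => m z i j) offReal
  jump : ∀ lam : ℝ, lam ∉ branchPoints A₁ A₂ →
    ∃ mPlus mMinus : Matrix (Fin 2) (Fin 2) ℂ,
      Tendsto m (𝓝[{z : ℂ | 0 < z.im}] (lam : ℂ)) (𝓝 mPlus) ∧
      Tendsto m (𝓝[{z : ℂ | z.im < 0}] (lam : ℂ)) (𝓝 mMinus) ∧
      mPlus = mMinus * jumpMatrix A₁ A₂ r y t lam
  decay : ∀ i j, (fun z => m z i j) =O[Bornology.cobounded ℂ ⊓ 𝓟 offReal] (fun z : ℂ => z⁻¹)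
  singularity : ∀ s ∈ branchPoints A₁ A₂, ∀ i j,
    (fun z => m z i j) =O[𝓝[offReal] (s : ℂ)] (fun z : ℂ => ‖z - (s : ℂ)‖ ^ (-(1 / 4) : ℝ))

end

end StepMCH

/-!
For real `λ` the quantity `2 Im (ψ₀ ψ̄₁)` is constant along solutions of the Lax equation, and where
`l_j` is real the gauge matrix `H_j` turns it into the indefinite form `|w₀|² - |w₁|²`. Evaluating
it at both ends of the line gives `|c₁₁|² - |c₂₁|² = 1` on `Σ̇₁`, and `= 0` on `Σ̇₀`, where the left
Jost solution decays; hence `|r| < 1` on `Σ̇₁` and `|r| = 1` on `Σ̇₀`. Therefore `Ĝ + Ĝ*` is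
positive semidefinite off the branch points and positive definite on `Σ̇₁`.

Let `u` be a row of `m`. In the upper half plane, `u(z) u(z̄)*` is analytic, is `O(z⁻²)` at infinity
and has integrable singularities, so its boundary values `u₋ Ĝ u₋*` have integral zero. Their real
part `½ u₋ (Ĝ + Ĝ*) u₋*` is nonnegative, so it vanishes identically, and `u₋ = u₊ = 0` on `Σ̇₁`.
An analytic function on a half plane with zero boundary values on an interval is zero.
-/

namespace StepMCH

open Filter Topology MeasureTheory Asymptotics
open Complex (I)
open UpperHalfPlane (upperHalfPlaneSet isOpen_upperHalfPlaneSet)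
open scoped Matrix ComplexConjugate ComplexOrder

local notation "ℍₒ" => upperHalfPlaneSet

section RectangleIntegral

variable {E : Type*} [NormedAddCommGroup E] [NormedSpace ℂ E]

/-- The integral of `f` over the boundary of the rectangle `[[a₁, a₂]] × [[b₁, b₂]]`. -/
noncomputable def rectBoundaryIntegral (f : ℂ → E) (a₁ a₂ b₁ b₂ : ℝ) : E :=
  (∫ x in a₁..a₂, f (x + b₁ * I)) - (∫ x in a₁..a₂, f (x + b₂ * I)) +
    I • (∫ y in b₁..b₂, f (a₂ + y * I)) - I • (∫ y in b₁..b₂, f (a₁ + y * I))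

theorem rectBoundaryIntegral_add_adjacent {f : ℂ → E} {a₁ a₂ b₁ b c : ℝ}
    (hf : ContinuousOn f (Set.uIcc a₁ a₂ ×ℂ Set.uIcc b₁ c)) (hb : b ∈ Set.uIcc b₁ c) :
    rectBoundaryIntegral f a₁ a₂ b₁ b + rectBoundaryIntegral f a₁ a₂ b c =
      rectBoundaryIntegral f a₁ a₂ b₁ c := by
  have vertical {a : ℝ} (ha : a ∈ Set.uIcc a₁ a₂) :
      (∫ y in b₁..b, f (a + y * I)) + (∫ y in b..c, f (a + y * I)) =
        ∫ y in b₁..c, f (a + y * I) := by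
    have hcont : ContinuousOn (fun y : ℝ => f (a + y * I)) (Set.uIcc b₁ c) :=
      hf.comp (by fun_prop) fun y hy => ⟨by simpa using ha, by simpa using hy⟩
    exact intervalIntegral.integral_add_adjacent_intervals
      (hcont.mono (Set.uIcc_subset_uIcc_left hb)).intervalIntegrable
      (hcont.mono (Set.uIcc_subset_uIcc_right hb)).intervalIntegrable
  simp only [rectBoundaryIntegral, ← vertical Set.left_mem_uIcc, ← vertical Set.right_mem_uIcc,
    smul_add]
  abel

theorem rectBoundaryIntegral_eq_zero_of_notMem {f : ℂ → E} {a₁ a₂ b₁ b₂ : ℝ}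
    (hc : ContinuousOn f (Set.uIcc a₁ a₂ ×ℂ Set.uIcc b₁ b₂))
    (hd : DifferentiableOn ℂ f ((Set.uIcc a₁ a₂ ×ℂ Set.uIcc b₁ b₂) ∩ {z | z.im ≠ 0}))
    (h0 : (0 : ℝ) ∉ Set.Ioo (min b₁ b₂) (max b₁ b₂)) :
    rectBoundaryIntegral f a₁ a₂ b₁ b₂ = 0 := by
  have := Complex.integral_boundary_rect_eq_zero_of_continuousOn_of_differentiableOn f
    (a₁ + b₁ * I) (a₂ + b₂ * I) (by simpa using hc) (hd.mono fun z hz => ?_)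
  · simpa [rectBoundaryIntegral] using this
  · obtain ⟨hre, him⟩ : z.re ∈ Set.Ioo (min a₁ a₂) (max a₁ a₂) ∧
        z.im ∈ Set.Ioo (min b₁ b₂) (max b₁ b₂) := by simpa [Complex.mem_reProdIm] using hz
    exact ⟨⟨Set.Ioo_subset_Icc_self hre, Set.Ioo_subset_Icc_self him⟩,
      fun h => h0 (h ▸ him)⟩

theorem rectBoundaryIntegral_eq_zero {f : ℂ → E} {a₁ a₂ b₁ b₂ : ℝ}
    (hc : ContinuousOn f (Set.uIcc a₁ a₂ ×ℂ Set.uIcc b₁ b₂))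
    (hd : DifferentiableOn ℂ f ((Set.uIcc a₁ a₂ ×ℂ Set.uIcc b₁ b₂) ∩ {z | z.im ≠ 0})) :
    rectBoundaryIntegral f a₁ a₂ b₁ b₂ = 0 := by
  by_cases h0 : (0 : ℝ) ∈ Set.uIcc b₁ b₂
  · have hleft : Set.uIcc a₁ a₂ ×ℂ Set.uIcc b₁ 0 ⊆ Set.uIcc a₁ a₂ ×ℂ Set.uIcc b₁ b₂ :=
      Set.inter_subset_inter_right _ (Set.preimage_mono (Set.uIcc_subset_uIcc_left h0))
    have hright : Set.uIcc a₁ a₂ ×ℂ Set.uIcc 0 b₂ ⊆ Set.uIcc a₁ a₂ ×ℂ Set.uIcc b₁ b₂ :=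
      Set.inter_subset_inter_right _ (Set.preimage_mono (Set.uIcc_subset_uIcc_right h0))
    rw [← rectBoundaryIntegral_add_adjacent hc h0,
      rectBoundaryIntegral_eq_zero_of_notMem (hc.mono hleft)
        (hd.mono (Set.inter_subset_inter_left _ hleft)) (by grind),
      rectBoundaryIntegral_eq_zero_of_notMem (hc.mono hright)
        (hd.mono (Set.inter_subset_inter_left _ hright)) (by grind), add_zero]
  · exact rectBoundaryIntegral_eq_zero_of_notMem hc hd fun h => h0 (Set.Ioo_subset_Icc_self h)

theorem differentiableOn_ball_of_im_ne_zero [CompleteSpace E] {f : ℂ → E} {c : ℂ} {r : ℝ}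
    (hc : ContinuousOn f (Metric.ball c r))
    (hd : DifferentiableOn ℂ f (Metric.ball c r ∩ {z | z.im ≠ 0})) :
    DifferentiableOn ℂ f (Metric.ball c r) := by
  refine (Complex.IsConservativeOn.isExactOn_ball hc fun z w hzw => ?_).differentiableOn
    Metric.isOpen_ball
  rw [← add_eq_zero_iff_eq_neg, Complex.wedgeIntegral_add_wedgeIntegral_eq]
  exact rectBoundaryIntegral_eq_zero (hc.mono hzw)
    (hd.mono (Set.inter_subset_inter_left _ hzw))

end RectangleIntegral

section BoundaryValues

variable {E : Type*} [NormedAddCommGroup E]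

theorem ofReal_mem_closure_upperHalfPlaneSet (x : ℝ) : (x : ℂ) ∈ closure ℍₒ := by
  simp

theorem tendsto_ofReal_add_mul_I (x : ℝ) :
    Tendsto (fun ε : ℝ => (x : ℂ) + ε * I) (𝓝[>] 0) (𝓝[ℍₒ] x) := by
  refine tendsto_nhdsWithin_iff.2 ⟨?_, ?_⟩
  · refine (Continuous.tendsto' ?_ 0 (x : ℂ) (by simp)).mono_left nhdsWithin_le_nhds
    fun_prop
  · filter_upwards [self_mem_nhdsWithin] with ε hε
    simpa using hε

theorem intervalIntegrable_abs_sub_rpow {r : ℝ} (hr : -1 < r) (s a b : ℝ) :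
    IntervalIntegrable (fun x => |x - s| ^ r) volume a b := by
  have from_zero (c : ℝ) : IntervalIntegrable (fun x : ℝ => |x| ^ r) volume 0 c :=
    intervalIntegrable_of_even (fun x => by simp)
      (fun c hc => (intervalIntegral.intervalIntegrable_rpow' (a := 0) (b := c) hr).congr
        fun x hx => by
          rw [Set.uIoc_of_le hc.le] at hx
          simp [abs_of_pos hx.1]) enorm_ne_top enorm_ne_top
  simpa using ((from_zero (a - s)).symm.trans (from_zero (b - s))).comp_sub_right s

theorem isBigO_principal_inter_of_isCompact {X F : Type*} [TopologicalSpace X]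
    [NormedAddCommGroup F] {f : X → E} {g : X → F} {K U : Set X} (hK : IsCompact K)
    (h : ∀ z ∈ K, f =O[𝓝[U] z] g) : f =O[𝓟 (K ∩ U)] g := by
  refine hK.induction_on (p := fun K => f =O[𝓟 (K ∩ U)] g) ?_ ?_ ?_ ?_
  · simp
  · intro s t hst ht
    exact ht.mono (principal_mono.2 (Set.inter_subset_inter_left U hst))
  · intro s t hs ht
    simpa only [Set.union_inter_distrib_right, ← sup_principal] using hs.sup ht
  · intro z hz
    obtain ⟨c, hc⟩ := (h z hz).bound
    exact ⟨_, mem_nhdsWithin_of_mem_nhds (eventually_nhdsWithin_iff.1 hc),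
      IsBigO.of_bound c (eventually_principal.2 fun w hw => hw.1 hw.2)⟩

/-- The weight `1 + ∑ ‖z - s‖⁻ᵖ` dominating functions whose only singularities are of order `p`,
at the points of `S`. -/
noncomputable def singularWeight (S : Finset ℝ) (p : ℝ) (z : ℂ) : ℝ :=
  1 + ∑ s ∈ S, ‖z - s‖ ^ (-p)

theorem one_le_singularWeight (S : Finset ℝ) (p : ℝ) (z : ℂ) : 1 ≤ singularWeight S p z :=
  le_add_of_nonneg_right (Finset.sum_nonneg fun _ _ => by positivity)

theorem rpow_neg_le_singularWeight {S : Finset ℝ} {s : ℝ} (hs : s ∈ S) (p : ℝ) (z : ℂ) :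
    ‖z - s‖ ^ (-p) ≤ singularWeight S p z :=
  (Finset.single_le_sum (f := fun s : ℝ => ‖z - s‖ ^ (-p)) (fun _ _ => by positivity) hs).trans
    (le_add_of_nonneg_left zero_le_one)

theorem intervalIntegrable_singularWeight (S : Finset ℝ) {p : ℝ} (hp : p < 1) (a b : ℝ) :
    IntervalIntegrable (fun x : ℝ => singularWeight S p x) volume a b := by
  refine intervalIntegrable_const.add ?_
  simpa [← Complex.ofReal_sub, Finset.sum_fn] using
    IntervalIntegrable.sum S (f := fun s x => |x - s| ^ (-p))
      fun s _ => intervalIntegrable_abs_sub_rpow (by linarith) s a b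

theorem singularWeight_add_mul_I_le {S : Finset ℝ} {p x : ℝ} (hp : 0 ≤ p) (hx : x ∉ S) (ε : ℝ) :
    singularWeight S p (x + ε * I) ≤ singularWeight S p x := by
  refine add_le_add_right (Finset.sum_le_sum fun s hs => ?_) 1
  refine Real.rpow_le_rpow_of_nonpos ?_ ?_ (neg_nonpos.2 hp)
  · rw [norm_pos_iff, ← Complex.ofReal_sub, Complex.ofReal_ne_zero, sub_ne_zero]
    exact fun h => hx (h ▸ hs)
  · simpa [← Complex.ofReal_sub] using Complex.abs_re_le_norm ((x : ℂ) + ε * I - s)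

/-- `F`, continuous on the open upper half plane, has the boundary values `g` on `ℝ ∖ S`, and at
the points of `S` singularities of order at most `p`. The values of `g` on `S` are irrelevant. -/
structure HasBoundaryValues (S : Finset ℝ) (p : ℝ) (F : ℂ → E) (g : ℝ → E) : Prop where
  continuousOn : ContinuousOn F ℍₒ
  tendsto : ∀ x ∉ S, Tendsto F (𝓝[ℍₒ] (x : ℂ)) (𝓝 (g x))
  isBigO : ∀ s ∈ S, F =O[𝓝[ℍₒ] (s : ℂ)] fun z => ‖z - s‖ ^ (-p)

namespace HasBoundaryValues

variable {S : Finset ℝ} {p : ℝ} {F : ℂ → E} {g : ℝ → E}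

theorem continuousOn_compl (h : HasBoundaryValues S p F g) : ContinuousOn g (S : Set ℝ)ᶜ := by
  have hext := continuousOn_extendFrom (f := F) (A := ℍₒ) (B := Complex.ofReal '' (S : Set ℝ)ᶜ)
    (Set.forall_mem_image.2 fun x _ => ofReal_mem_closure_upperHalfPlaneSet x)
    (Set.forall_mem_image.2 fun x hx => ⟨g x, h.tendsto x hx⟩)
  exact (hext.comp Complex.continuous_ofReal.continuousOn (Set.mapsTo_image _ _)).congr fun x hx =>
    (extendFrom_eq (ofReal_mem_closure_upperHalfPlaneSet x) (h.tendsto x hx)).symm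

theorem isBigO_singularWeight (h : HasBoundaryValues S p F g) {z : ℂ} (hz : 0 ≤ z.im) :
    F =O[𝓝[ℍₒ] z] singularWeight S p := by
  have one_isBigO : (fun _ => (1 : ℝ)) =O[𝓝[ℍₒ] z] singularWeight S p :=
    isBigO_of_le _ fun w => by
      simpa using (one_le_singularWeight S p w).trans (le_abs_self _)
  rcases hz.eq_or_lt with hz | hz
  · obtain ⟨x, rfl⟩ : ∃ x : ℝ, (x : ℂ) = z := ⟨z.re, Complex.ext (by simp) (by simp [← hz])⟩
    by_cases hx : x ∈ S
    · refine (h.isBigO x hx).trans (isBigO_of_le _ fun w => ?_)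
      rw [Real.norm_of_nonneg (by positivity)]
      exact (rpow_neg_le_singularWeight hx p w).trans (le_abs_self _)
    · exact ((h.tendsto x hx).isBigO_one ℝ).trans one_isBigO
  · exact ((h.continuousOn z hz).tendsto.isBigO_one ℝ).trans one_isBigO

theorem exists_norm_le_singularWeight (h : HasBoundaryValues S p F g) (hp : 0 ≤ p)
    (a b : ℝ) : ∃ C, ∀ x ∈ Set.uIcc a b, x ∉ S → ∀ ε ∈ Set.Ioc (0 : ℝ) 1,
      ‖F (x + ε * I)‖ ≤ C * singularWeight S p x := by
  have hK : IsCompact (Set.uIcc a b ×ℂ Set.Icc 0 1) := isCompact_uIcc.reProdIm isCompact_Icc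
  obtain ⟨C, hC, hbound⟩ := (isBigO_principal_inter_of_isCompact hK fun z hz =>
    h.isBigO_singularWeight hz.2.1).exists_pos
  refine ⟨C, fun x hx hxS ε hε => ?_⟩
  have hmem : (x + ε * I : ℂ) ∈ (Set.uIcc a b ×ℂ Set.Icc 0 1) ∩ ℍₒ :=
    ⟨⟨by simpa using hx, by simpa using ⟨hε.1.le, hε.2⟩⟩, by simpa using hε.1⟩
  refine (eventually_principal.1 hbound.bound _ hmem).trans ?_
  rw [Real.norm_of_nonneg (zero_le_one.trans (one_le_singularWeight S p _))]
  exact mul_le_mul_of_nonneg_left (singularWeight_add_mul_I_le hp hxS ε) hC.le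

theorem tendsto_vertical (h : HasBoundaryValues S p F g) {x : ℝ} (hx : x ∉ S) :
    Tendsto (fun ε : ℝ => F (x + ε * I)) (𝓝[>] 0) (𝓝 (g x)) :=
  (h.tendsto x hx).comp (tendsto_ofReal_add_mul_I x)

theorem aestronglyMeasurable (h : HasBoundaryValues S p F g) : AEStronglyMeasurable g := by
  rw [← Measure.restrict_eq_self_of_ae_mem (s := (S : Set ℝ)ᶜ)
    (S.finite_toSet.countable.ae_notMem volume)]
  exact h.continuousOn_compl.aestronglyMeasurable S.measurableSet.compl

theorem intervalIntegrable (h : HasBoundaryValues S p F g) (hp₀ : 0 ≤ p) (hp₁ : p < 1) (a b : ℝ) :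
    IntervalIntegrable g volume a b := by
  obtain ⟨C, hC⟩ := h.exists_norm_le_singularWeight hp₀ a b
  refine ((intervalIntegrable_singularWeight S hp₁ a b).const_mul C).mono_fun'
    h.aestronglyMeasurable.restrict ?_
  filter_upwards [ae_restrict_of_ae (S.finite_toSet.countable.ae_notMem volume),
    ae_restrict_mem measurableSet_uIoc] with x hxS hx
  refine le_of_tendsto (h.tendsto_vertical hxS).norm ?_
  filter_upwards [Ioc_mem_nhdsGT one_pos] with ε hε
  exact hC x (Set.uIoc_subset_uIcc hx) hxS ε hε

theorem tendsto_intervalIntegral [NormedSpace ℝ E] (h : HasBoundaryValues S p F g) (hp₀ : 0 ≤ p)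
    (hp₁ : p < 1) (a b : ℝ) :
    Tendsto (fun ε : ℝ => ∫ x in a..b, F (x + ε * I)) (𝓝[>] 0) (𝓝 (∫ x in a..b, g x)) := by
  obtain ⟨C, hC⟩ := h.exists_norm_le_singularWeight hp₀ a b
  refine intervalIntegral.tendsto_integral_filter_of_dominated_convergence
    (fun x : ℝ => C * singularWeight S p x) ?_ ?_
    ((intervalIntegrable_singularWeight S hp₁ a b).const_mul C) ?_
  · filter_upwards [self_mem_nhdsWithin] with ε hε
    have : Continuous fun x : ℝ => F (x + ε * I) :=
      h.continuousOn.comp_continuous (by fun_prop) fun x => by simpa using hε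
    exact this.aestronglyMeasurable
  · filter_upwards [Ioc_mem_nhdsGT one_pos] with ε hε
    filter_upwards [S.finite_toSet.countable.ae_notMem volume] with x hxS hx
    exact hC x (Set.uIoc_subset_uIcc hx) hxS ε hε
  · filter_upwards [S.finite_toSet.countable.ae_notMem volume] with x hxS _
    exact h.tendsto_vertical hxS

end HasBoundaryValues

theorem norm_integral_horizontal_le [NormedSpace ℂ E] {F : ℂ → E}
    (hF : DifferentiableOn ℂ F ℍₒ) {M R ε : ℝ} (hR : 0 ≤ R) (hε : 0 < ε)
    (hM : ∀ z ∈ ℍₒ, R ≤ ‖z‖ → ‖F z‖ ≤ M) :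
    ‖∫ x in -R..R, F (x + ε * I)‖ ≤ 4 * R * M := by
  have cauchy : (∫ x in -R..R, F (x + ε * I)) - (∫ x in -R..R, F (x + (R + ε : ℝ) * I))
      + I • (∫ y in ε..R + ε, F (R + y * I)) - I • (∫ y in ε..R + ε, F ((-R : ℝ) + y * I)) = 0 := by
    have hsub : Set.uIcc (-R) R ×ℂ Set.uIcc ε (R + ε) ⊆ ℍₒ := fun z hz => by
      rw [Set.uIcc_of_le (show ε ≤ R + ε by linarith)] at hz
      exact hε.trans_le hz.2.1
    exact rectBoundaryIntegral_eq_zero (hF.continuousOn.mono hsub)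
      (hF.mono (Set.inter_subset_left.trans hsub))
  have top : ‖∫ x in -R..R, F (x + (R + ε : ℝ) * I)‖ ≤ M * |R - -R| := by
    refine intervalIntegral.norm_integral_le_of_norm_le_const fun x _ => hM _ ?_ ?_
    · simpa using add_pos_of_nonneg_of_pos hR hε
    · have : R + ε ≤ ‖(x : ℂ) + (R + ε : ℝ) * I‖ := by
        simpa using Complex.im_le_norm ((x : ℂ) + (R + ε : ℝ) * I)
      linarith
  have side (c : ℝ) (hc : |c| = R) : ‖∫ y in ε..(R + ε), F (c + y * I)‖ ≤ M * |R + ε - ε| := by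
    refine intervalIntegral.norm_integral_le_of_norm_le_const fun y hy => hM _ ?_ ?_
    · rw [Set.uIoc_of_le (by linarith)] at hy
      simpa using hε.trans hy.1
    · simpa [hc] using Complex.abs_re_le_norm ((c : ℂ) + y * I)
  have right := side R (abs_of_nonneg hR)
  have left := side (-R) (by rw [abs_neg, abs_of_nonneg hR])
  rw [show |R - -R| = 2 * R by rw [sub_neg_eq_add, ← two_mul, abs_of_nonneg (by linarith)]] at top
  rw [add_sub_cancel_right, abs_of_nonneg hR] at right left
  calc ‖∫ x in -R..R, F (x + ε * I)‖
      = ‖(∫ x in -R..R, F (x + (R + ε : ℝ) * I)) - I • (∫ y in ε..R + ε, F (R + y * I))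
          + I • (∫ y in ε..R + ε, F ((-R : ℝ) + y * I))‖ :=
        congrArg norm (by rw [← sub_eq_zero, ← cauchy]; abel)
    _ ≤ ‖∫ x in -R..R, F (x + (R + ε : ℝ) * I)‖ + ‖∫ y in ε..R + ε, F (R + y * I)‖
          + ‖∫ y in ε..R + ε, F ((-R : ℝ) + y * I)‖ := by
        refine norm_add_le_of_le ((norm_sub_le _ _).trans_eq ?_) ?_ <;> simp [norm_smul]
    _ ≤ 4 * R * M := by linarith

namespace HasBoundaryValues

variable {S : Finset ℝ} {p : ℝ}

theorem tendsto_integral_zero [NormedSpace ℂ E] {F : ℂ → E} {g : ℝ → E}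
    (h : HasBoundaryValues S p F g) (hp₀ : 0 ≤ p) (hp₁ : p < 1) (hF : DifferentiableOn ℂ F ℍₒ)
    (hdecay : F =o[Bornology.cobounded ℂ ⊓ 𝓟 ℍₒ] fun z => z⁻¹) :
    Tendsto (fun R : ℝ => ∫ x in -R..R, g x) atTop (𝓝 0) := by
  refine Metric.tendsto_atTop.2 fun δ hδ => ?_
  obtain ⟨R₀, hR₀⟩ : ∃ R₀, ∀ z ∈ ℍₒ, R₀ ≤ ‖z‖ → ‖F z‖ ≤ δ / 8 * ‖z⁻¹‖ := by
    have hev := eventually_inf_principal.1 (hdecay.bound (show 0 < δ / 8 by positivity))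
    rw [← comap_norm_atTop, eventually_comap] at hev
    obtain ⟨R₀, hR₀⟩ := eventually_atTop.1 hev
    exact ⟨R₀, fun z hz hle => hR₀ _ hle z rfl hz⟩
  refine ⟨max R₀ 1, fun R hR => ?_⟩
  have hR_pos : 0 < R := one_pos.trans_le ((le_max_right _ _).trans hR)
  have horizontal : ∀ᶠ ε : ℝ in 𝓝[>] 0, ‖∫ x in -R..R, F (x + ε * I)‖ ≤ δ / 2 := by
    filter_upwards [self_mem_nhdsWithin] with ε hε
    refine (norm_integral_horizontal_le hF (M := δ / 8 * R⁻¹) hR_pos.le hε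
      fun z hz hRz => ?_).trans_eq (by field_simp; ring)
    refine (hR₀ z hz ((le_max_left _ _).trans (hR.trans hRz))).trans ?_
    rw [norm_inv]
    gcongr
  rw [dist_zero_right]
  exact (le_of_tendsto (h.tendsto_intervalIntegral hp₀ hp₁ (-R) R).norm horizontal).trans_lt
    (half_lt_self hδ)

theorem re_eq_zero_of_re_nonneg {F : ℂ → ℂ} {g : ℝ → ℂ} (h : HasBoundaryValues S p F g)
    (hp₀ : 0 ≤ p) (hp₁ : p < 1) (hF : DifferentiableOn ℂ F ℍₒ)
    (hdecay : F =o[Bornology.cobounded ℂ ⊓ 𝓟 ℍₒ] fun z => z⁻¹) (hg : ∀ x ∉ S, 0 ≤ (g x).re) :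
    ∀ x ∉ S, (g x).re = 0 := by
  have hg_ae : ∀ᵐ x : ℝ, 0 ≤ (g x).re := by
    filter_upwards [S.finite_toSet.countable.ae_notMem volume] with x hx using hg x hx
  have hint (a b : ℝ) : IntervalIntegrable (fun x => (g x).re) volume a b :=
    ⟨(h.intervalIntegrable hp₀ hp₁ a b).1.re, (h.intervalIntegrable hp₀ hp₁ a b).2.re⟩
  have hlim : Tendsto (fun R : ℝ => ∫ x in -R..R, (g x).re) atTop (𝓝 0) := by
    have := (Complex.continuous_re.tendsto 0).comp (h.tendsto_integral_zero hp₀ hp₁ hF hdecay)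
    refine this.congr fun R => ?_
    exact (Complex.reCLM.intervalIntegral_comp_comm (h.intervalIntegrable hp₀ hp₁ (-R) R)).symm
  have integral_eq_zero (R : ℝ) (hR : 0 ≤ R) : ∫ x in -R..R, (g x).re = 0 := by
    refine le_antisymm (ge_of_tendsto hlim ?_)
      (intervalIntegral.integral_nonneg_of_ae (by linarith) hg_ae)
    filter_upwards [eventually_ge_atTop R] with R' hR'
    exact intervalIntegral.integral_mono_interval (by linarith) (by linarith) hR'
      (ae_restrict_of_ae hg_ae) (hint _ _)
  intro x hx
  have hR : -(|x| + 1) < |x| + 1 := by linarith [abs_nonneg x]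
  have ae_zero := (intervalIntegral.integral_eq_zero_iff_of_le_of_nonneg_ae hR.le
    (ae_restrict_of_ae hg_ae) (hint _ _)).1 (integral_eq_zero _ (by positivity))
  have eqOn_zero := Measure.eqOn_open_of_ae_eq (μ := volume)
    (U := Set.Ioo (-(|x| + 1)) (|x| + 1) ∩ (S : Set ℝ)ᶜ)
    (ae_restrict_of_ae_restrict_of_subset
      (Set.inter_subset_left.trans Set.Ioo_subset_Ioc_self) ae_zero)
    (isOpen_Ioo.inter S.finite_toSet.isClosed.isOpen_compl)
    (Complex.continuous_re.comp_continuousOn (h.continuousOn_compl.mono Set.inter_subset_right))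
    continuousOn_const
  exact eqOn_zero ⟨abs_lt.1 (lt_add_one _), hx⟩

theorem dotProduct {ι : Type*} [Fintype ι] {q : ℝ} {u w : ℂ → ι → ℂ} {a b : ℝ → ι → ℂ}
    (hu : HasBoundaryValues S p u a) (hw : HasBoundaryValues S q w b) :
    HasBoundaryValues S (p + q) (fun z => u z ⬝ᵥ w z) (fun x => a x ⬝ᵥ b x) where
  continuousOn := continuousOn_finsetSum _ fun i _ =>
    (continuousOn_pi.1 hu.continuousOn i).mul (continuousOn_pi.1 hw.continuousOn i)
  tendsto x hx := tendsto_finsetSum _ fun i _ =>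
    (tendsto_pi_nhds.1 (hu.tendsto x hx) i).mul (tendsto_pi_nhds.1 (hw.tendsto x hx) i)
  isBigO s hs := by
    refine (IsBigO.sum fun i _ => (isBigO_pi.1 (hu.isBigO s hs) i).mul
      (isBigO_pi.1 (hw.isBigO s hs) i)).congr'
        (.of_eq (funext fun z => Finset.sum_apply z _ _)) ?_
    filter_upwards [self_mem_nhdsWithin] with z hz
    have hzs : 0 < ‖z - s‖ := norm_pos_iff.2 (sub_ne_zero.2 fun h => by simp [h] at hz)
    rw [neg_add, Real.rpow_add hzs]

end HasBoundaryValues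

end BoundaryValues

section BoundaryUniqueness

variable {E : Type*} [NormedAddCommGroup E] [NormedSpace ℂ E]

theorem continuousAt_indicator_of_isOpen {X F : Type*} [TopologicalSpace X] [TopologicalSpace F]
    [Zero F] {U : Set X} {f : X → F} {x : X} (hU : IsOpen U) (hf : ContinuousOn f U)
    (hx : x ∉ U → Tendsto f (𝓝[U] x) (𝓝 0)) : ContinuousAt (U.indicator f) x := by
  by_cases hxU : x ∈ U
  · exact ((hf x hxU).continuousAt (hU.mem_nhds hxU)).congr
      (Set.eqOn_indicator.symm.eventuallyEq_of_mem (hU.mem_nhds hxU))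
  · rw [ContinuousAt, Set.indicator_of_notMem hxU, ← nhdsWithin_univ, ← Set.union_compl_self U,
      nhdsWithin_union]
    refine Tendsto.sup ((hx hxU).congr' ?_) (tendsto_const_nhds.congr' ?_)
    · filter_upwards [self_mem_nhdsWithin] with y hy using (Set.indicator_of_mem hy f).symm
    · filter_upwards [self_mem_nhdsWithin] with y hy using (Set.indicator_of_notMem hy f).symm

theorem differentiableOn_indicator_upperHalfPlaneSet {f : ℂ → E} (hf : DifferentiableOn ℂ f ℍₒ) :
    DifferentiableOn ℂ (Set.indicator ℍₒ f) {z | z.im ≠ 0} := by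
  intro z hz
  refine DifferentiableAt.differentiableWithinAt ?_
  rcases (show z.im ≠ 0 from hz).lt_or_gt with hz | hz
  · refine (differentiableAt_const (0 : E)).congr_of_eventuallyEq ?_
    filter_upwards [(isOpen_lt Complex.continuous_im continuous_const).mem_nhds hz] with w hw
    exact Set.indicator_of_notMem (s := ℍₒ) (fun h => lt_asymm hw h) f
  · exact (hf.differentiableAt (isOpen_upperHalfPlaneSet.mem_nhds hz)).congr_of_eventuallyEq
      (Set.eqOn_indicator.eventuallyEq_of_mem (isOpen_upperHalfPlaneSet.mem_nhds hz))

-- Extended by zero to the lower half plane, `f` is analytic across the real line near `x₀`.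
theorem eqOn_zero_of_tendsto_zero [CompleteSpace E] {f : ℂ → E} (hf : DifferentiableOn ℂ f ℍₒ)
    {x₀ : ℝ} (h : ∀ᶠ x : ℝ in 𝓝 x₀, Tendsto f (𝓝[ℍₒ] (x : ℂ)) (𝓝 0)) : Set.EqOn f 0 ℍₒ := by
  obtain ⟨δ, hδ, hball⟩ := Metric.eventually_nhds_iff_ball.1 h
  have hF : DifferentiableOn ℂ (Set.indicator ℍₒ f) (Metric.ball x₀ δ) := by
    refine differentiableOn_ball_of_im_ne_zero (fun w hw => ?_)
      ((differentiableOn_indicator_upperHalfPlaneSet hf).mono Set.inter_subset_right)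
    refine (continuousAt_indicator_of_isOpen isOpen_upperHalfPlaneSet hf.continuousOn
      fun hw_notMem => ?_).continuousWithinAt
    rcases (not_lt.1 (show ¬0 < w.im from hw_notMem)).eq_or_lt with him | him
    · obtain ⟨x, rfl⟩ : ∃ x : ℝ, (x : ℂ) = w := ⟨w.re, Complex.ext (by simp) (by simp [him])⟩
      exact hball x (by simpa [Complex.dist_of_im_eq, Real.dist_eq] using hw)
    · have hw_closure : w ∉ closure ℍₒ := by simpa using him
      rw [notMem_closure_iff_nhdsWithin_eq_bot.1 hw_closure]
      exact tendsto_bot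
  have vertical (s : ℝ) (hs : |s| < δ) : (x₀ + s * I : ℂ) ∈ Metric.ball (x₀ : ℂ) δ := by
    simpa [dist_eq_norm] using hs
  have zero_below : Set.indicator ℍₒ f =ᶠ[𝓝 (x₀ + (-(δ / 2) : ℝ) * I)] 0 := by
    filter_upwards [(isOpen_lt Complex.continuous_im continuous_const).mem_nhds
      (show (x₀ + (-(δ / 2) : ℝ) * I : ℂ).im < 0 by simpa using hδ)] with w hw
    exact Set.indicator_of_notMem (s := ℍₒ) (fun h => lt_asymm hw h) f
  have hF_analytic := hF.analyticOnNhd Metric.isOpen_ball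
  have zero_ball := hF_analytic.eqOn_zero_of_preconnected_of_eventuallyEq_zero
    (convex_ball _ _).isPreconnected (vertical _ (by rw [abs_neg, abs_of_pos] <;> linarith))
    zero_below
  refine (hf.analyticOnNhd isOpen_upperHalfPlaneSet).eqOn_zero_of_preconnected_of_eventuallyEq_zero
    (convex_halfSpace_im_gt 0).isPreconnected (z₀ := x₀ + (δ / 2 : ℝ) * I) (by simpa using hδ) ?_
  filter_upwards [Metric.isOpen_ball.mem_nhds (vertical (δ / 2) (by rw [abs_of_pos] <;> linarith)),
    isOpen_upperHalfPlaneSet.mem_nhds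
      (show (x₀ + (δ / 2 : ℝ) * I : ℂ) ∈ ℍₒ by simpa using hδ)] with w hw hw_im
  rw [← Set.indicator_of_mem (s := ℍₒ) hw_im f, zero_ball hw]

end BoundaryUniqueness

theorem two_mul_re_star_vecMul_dotProduct {ι : Type*} [Fintype ι] (G : Matrix ι ι ℂ) (v : ι → ℂ) :
    2 * ((star v ᵥ* G) ⬝ᵥ v).re = (star v ⬝ᵥ (G + Gᴴ) *ᵥ v).re := by
  have conj_eq : star v ⬝ᵥ Gᴴ *ᵥ v = star (star v ⬝ᵥ G *ᵥ v) := by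
    rw [Matrix.star_dotProduct, Matrix.star_mulVec, Matrix.conjTranspose_conjTranspose,
      ← Matrix.dotProduct_mulVec]
  rw [← Matrix.dotProduct_mulVec, Matrix.add_mulVec, dotProduct_add, conj_eq, Complex.add_re]
  simp [two_mul]

theorem rpow_neg_half_mul_self {x : ℝ} (hx : 0 ≤ x) :
    x ^ (-(1 / 2) : ℝ) * x ^ (-(1 / 2) : ℝ) = x⁻¹ := by
  rw [← Real.rpow_add' hx (by norm_num), ← Real.rpow_neg_one]
  norm_num

theorem isLittleO_dotProduct_inv {ι : Type*} [Fintype ι] {l : Filter ℂ} {u w : ℂ → ι → ℂ}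
    (hu : u =o[l] fun z => ‖z‖ ^ (-(1 / 2) : ℝ)) (hw : w =o[l] fun z => ‖z‖ ^ (-(1 / 2) : ℝ)) :
    (fun z => u z ⬝ᵥ w z) =o[l] fun z => z⁻¹ := by
  have hmul : (fun z => u z ⬝ᵥ w z) =o[l] fun z => ‖z‖ ^ (-(1 / 2) : ℝ) * ‖z‖ ^ (-(1 / 2) : ℝ) :=
    (IsLittleO.sum fun i _ => (isLittleO_pi.1 hu i).mul (isLittleO_pi.1 hw i)).congr_left
      fun z => Finset.sum_apply z _ _
  refine hmul.trans_le fun z => ?_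
  rw [rpow_neg_half_mul_self (norm_nonneg z), norm_inv, norm_inv, norm_norm]

theorem eqOn_zero_of_jump {ι : Type*} [Fintype ι] {S : Finset ℝ} {p : ℝ} (hp₀ : 0 ≤ p)
    (hp : p < 1 / 2) {u w : ℂ → ι → ℂ} {a b : ℝ → ι → ℂ} (hu : HasBoundaryValues S p u a)
    (hw : HasBoundaryValues S p w b) (hu_diff : DifferentiableOn ℂ u ℍₒ)
    (hw_diff : DifferentiableOn ℂ w ℍₒ)
    (hu_decay : u =o[Bornology.cobounded ℂ ⊓ 𝓟 ℍₒ] fun z => ‖z‖ ^ (-(1 / 2) : ℝ))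
    (hw_decay : w =o[Bornology.cobounded ℂ ⊓ 𝓟 ℍₒ] fun z => ‖z‖ ^ (-(1 / 2) : ℝ))
    {G : ℝ → Matrix ι ι ℂ} (hjump : ∀ x ∉ S, a x = star (b x) ᵥ* G x)
    (hG : ∀ x ∉ S, (G x + (G x)ᴴ).PosSemidef) {x₀ : ℝ}
    (hG_pos : ∀ᶠ x in 𝓝 x₀, x ∉ S ∧ (G x + (G x)ᴴ).PosDef) :
    Set.EqOn u 0 ℍₒ ∧ Set.EqOn w 0 ℍₒ := by
  have hre (x : ℝ) (hx : x ∉ S) :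
      2 * (a x ⬝ᵥ b x).re = (star (b x) ⬝ᵥ (G x + (G x)ᴴ) *ᵥ b x).re := by
    rw [hjump x hx, two_mul_re_star_vecMul_dotProduct]
  have re_eq_zero : ∀ x ∉ S, (a x ⬝ᵥ b x).re = 0 := by
    refine (hu.dotProduct hw).re_eq_zero_of_re_nonneg (by linarith) (by linarith)
      (DifferentiableOn.fun_sum fun i _ => (differentiableOn_pi.1 hu_diff i).mul
        (differentiableOn_pi.1 hw_diff i)) (isLittleO_dotProduct_inv hu_decay hw_decay)
      fun x hx => ?_
    have := (Complex.le_def.1 ((hG x hx).dotProduct_mulVec_nonneg (b x))).1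
    rw [Complex.zero_re] at this
    linarith [hre x hx]
  have boundary_zero : ∀ᶠ x in 𝓝 x₀, x ∉ S ∧ a x = 0 ∧ b x = 0 := by
    filter_upwards [hG_pos] with x ⟨hx, hpos⟩
    have hb : b x = 0 := by
      by_contra hb
      have := (Complex.lt_def.1 (hpos.dotProduct_mulVec_pos hb)).1
      simp [← hre x hx, re_eq_zero x hx] at this
    exact ⟨hx, by rw [hjump x hx, hb, star_zero, Matrix.zero_vecMul], hb⟩
  constructor
  · refine eqOn_zero_of_tendsto_zero (x₀ := x₀) hu_diff ?_
    filter_upwards [boundary_zero] with x ⟨hx, ha, _⟩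
    exact ha ▸ hu.tendsto x hx
  · refine eqOn_zero_of_tendsto_zero (x₀ := x₀) hw_diff ?_
    filter_upwards [boundary_zero] with x ⟨hx, _, hb⟩
    exact hb ▸ hw.tendsto x hx

theorem rootL_sq (A : ℝ) (z : ℂ) : rootL A z ^ 2 = z ^ 2 - (1 / A ^ 2 : ℝ) := by
  have sq_cpow_half (w : ℂ) : (w ^ (1 / 2 : ℂ)) ^ 2 = w := by
    rw [← Complex.cpow_ofNat_mul]
    simp
  rw [rootL, mul_pow, sq_cpow_half, sq_cpow_half]
  push_cast
  ring

theorem sqrtCut_sq (z : ℂ) : sqrtCut z ^ 2 = z := by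
  rw [sqrtCut, mul_pow, ← Complex.cpow_ofNat_mul, Complex.I_sq]
  simp

theorem cpow_half_of_nonneg {x : ℝ} (hx : 0 ≤ x) : (x : ℂ) ^ (1 / 2 : ℂ) = √x := by
  rw [Real.sqrt_eq_rpow, Complex.ofReal_cpow hx]
  norm_num

theorem cpow_half_of_nonpos {x : ℝ} (hx : x ≤ 0) : (x : ℂ) ^ (1 / 2 : ℂ) = √(-x) * I := by
  rw [Complex.ofReal_cpow_of_nonpos hx, ← Complex.ofReal_neg, cpow_half_of_nonneg (by linarith),
    show (Real.pi * I * (1 / 2) : ℂ) = Real.pi / 2 * I by ring, Complex.exp_pi_div_two_mul_I]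

theorem exists_rootL_eq_of_mem_sigmaDot {A lam : ℝ} (hA : 0 < A) (h : lam ∈ sigmaDot A) :
    ∃ l : ℝ, rootL A lam = l ∧ 0 < l * lam := by
  have hA_inv : 0 < 1 / A := by positivity
  rw [rootL, ← Complex.ofReal_sub, ← Complex.ofReal_add]
  rcases lt_abs.1 (show 1 / A < |lam| from h) with hlam | hlam
  · rw [cpow_half_of_nonneg (by linarith), cpow_half_of_nonneg (by linarith)]
    refine ⟨√(lam - 1 / A) * √(lam + 1 / A), (Complex.ofReal_mul _ _).symm, ?_⟩
    exact mul_pos (mul_pos (Real.sqrt_pos.2 (by linarith)) (Real.sqrt_pos.2 (by linarith)))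
      (by linarith)
  · rw [cpow_half_of_nonpos (by linarith), cpow_half_of_nonpos (by linarith)]
    refine ⟨-(√(-(lam - 1 / A)) * √(-(lam + 1 / A))), ?_, ?_⟩
    · rw [mul_mul_mul_comm, Complex.I_mul_I]
      push_cast
      ring
    · exact mul_pos_of_neg_of_neg (neg_neg_of_pos (mul_pos (Real.sqrt_pos.2 (by linarith))
        (Real.sqrt_pos.2 (by linarith)))) (by linarith)

theorem exists_rootL_eq_of_mem_gammaDot {A lam : ℝ} (h : lam ∈ gammaDot A) :
    ∃ k : ℝ, 0 < k ∧ rootL A lam = k * I := by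
  obtain ⟨hneg, hpos⟩ := abs_lt.1 (show |lam| < 1 / A from h)
  rw [rootL, ← Complex.ofReal_sub, ← Complex.ofReal_add, cpow_half_of_nonpos (by linarith),
    cpow_half_of_nonneg (by linarith)]
  refine ⟨√(-(lam - 1 / A)) * √(lam + 1 / A), mul_pos (Real.sqrt_pos.2 (by linarith))
    (Real.sqrt_pos.2 (by linarith)), ?_⟩
  push_cast
  ring

/-- The rate `i A l(z)` common to the phases and to the gauge matrix. -/
noncomputable def phaseRate (A : ℝ) (z : ℂ) : ℂ := I * A * rootL A z

theorem phaseRate_sq {A : ℝ} (hA : A ≠ 0) (z : ℂ) : phaseRate A z ^ 2 = 1 - (z * A) ^ 2 := by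
  have hA' : (A : ℂ) ≠ 0 := Complex.ofReal_ne_zero.2 hA
  rw [phaseRate, mul_pow, mul_pow, rootL_sq, Complex.I_sq]
  push_cast
  field_simp
  ring

theorem exists_phaseRate_eq_of_mem_sigmaDot {A lam : ℝ} (hA : 0 < A) (h : lam ∈ sigmaDot A) :
    ∃ κ : ℝ, phaseRate A lam = κ * I ∧ 0 < κ * lam := by
  obtain ⟨l, hl, hpos⟩ := exists_rootL_eq_of_mem_sigmaDot hA h
  refine ⟨A * l, ?_, by rw [mul_assoc]; exact mul_pos hA hpos⟩
  rw [phaseRate, hl]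
  push_cast
  ring

theorem exists_phaseRate_eq_of_mem_gammaDot {A lam : ℝ} (hA : 0 < A) (h : lam ∈ gammaDot A) :
    ∃ κ : ℝ, κ < 0 ∧ phaseRate A lam = κ := by
  obtain ⟨k, hk, hl⟩ := exists_rootL_eq_of_mem_gammaDot h
  refine ⟨-(A * k), neg_neg_of_pos (mul_pos hA hk), ?_⟩
  rw [phaseRate, hl]
  push_cast
  linear_combination (A : ℂ) * k * Complex.I_sq

theorem phaseRate_re_eq_zero {A lam : ℝ} (hA : 0 < A) (h : lam ∈ sigmaDot A) :
    (phaseRate A lam).re = 0 := by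
  obtain ⟨κ, hκ, -⟩ := exists_phaseRate_eq_of_mem_sigmaDot hA h
  simp [hκ]

theorem phaseLeft_re_eq_zero {A lam : ℝ} (hA : 0 < A) (h : lam ∈ sigmaDot A) (m₀ : ℝ → ℝ)
    (x : ℝ) : (phaseLeft A m₀ x lam).re = 0 := by
  rw [phaseLeft, ← phaseRate, Complex.re_mul_ofReal, phaseRate_re_eq_zero hA h, zero_mul]

theorem phaseRight_re_eq_zero {A lam : ℝ} (hA : 0 < A) (h : lam ∈ sigmaDot A) (m₀ : ℝ → ℝ)
    (x : ℝ) : (phaseRight A m₀ x lam).re = 0 := by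
  rw [phaseRight, ← phaseRate, Complex.re_mul_ofReal, phaseRate_re_eq_zero hA h, zero_mul]

/-- The diagonal-to-off-diagonal ratio `z A / (1 - i A l(z))` in the gauge matrix. -/
noncomputable def gaugeRatio (A : ℝ) (z : ℂ) : ℂ := z * A / (1 - phaseRate A z)

/-- The scalar prefactor of the gauge matrix. -/
noncomputable def gaugeScale (A : ℝ) (z : ℂ) : ℂ :=
  (√(1 / 2) : ℝ) * sqrtCut (1 / phaseRate A z - 1)

theorem gaugeH_eq (A : ℝ) (z : ℂ) :
    gaugeH A z = gaugeScale A z • !![gaugeRatio A z, -1; -1, gaugeRatio A z] :=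
  rfl

theorem gaugeScale_sq (A : ℝ) (z : ℂ) : gaugeScale A z ^ 2 = (1 / phaseRate A z - 1) / 2 := by
  rw [gaugeScale, mul_pow, sqrtCut_sq, ← Complex.ofReal_pow, Real.sq_sqrt (by norm_num)]
  push_cast
  ring

theorem det_gaugeH {A : ℝ} {z : ℂ} (hA : A ≠ 0) (h₀ : phaseRate A z ≠ 0) (h₁ : phaseRate A z ≠ 1) :
    (gaugeH A z).det = 1 := by
  have hsub : 1 - phaseRate A z ≠ 0 := sub_ne_zero.2 h₁.symm
  rw [gaugeH_eq, Matrix.det_smul, Fintype.card_fin, gaugeScale_sq, Matrix.det_fin_two_of,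
    gaugeRatio]
  field_simp
  linear_combination phaseRate_sq hA z

theorem norm_one_sub_phaseRate {A lam : ℝ} (hA : 0 < A) (h : lam ∈ sigmaDot A) :
    ‖1 - phaseRate A lam‖ = |lam * A| := by
  obtain ⟨κ, hκ, -⟩ := exists_phaseRate_eq_of_mem_sigmaDot hA h
  have hsq : 1 + κ ^ 2 = (lam * A) ^ 2 := by
    have := phaseRate_sq hA.ne' (lam : ℂ)
    rw [hκ, mul_pow, Complex.I_sq] at this
    have : -κ ^ 2 = 1 - (lam * A) ^ 2 := by
      exact_mod_cast (by linear_combination this : (-κ ^ 2 : ℂ) = 1 - (lam * A) ^ 2)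
    linarith
  rw [hκ, ← sq_eq_sq₀ (norm_nonneg _) (abs_nonneg _), sq_abs, ← hsq, Complex.sq_norm,
    Complex.normSq_apply]
  simp only [Complex.sub_re, Complex.one_re, Complex.mul_re, Complex.ofReal_re, Complex.I_re,
    Complex.ofReal_im, Complex.I_im, Complex.sub_im, Complex.one_im, Complex.mul_im]
  ring

theorem ne_zero_of_mem_sigmaDot {A lam : ℝ} (hA : 0 < A) (h : lam ∈ sigmaDot A) : lam ≠ 0 :=
  abs_pos.1 ((one_div_pos.2 hA).trans h)

theorem norm_gaugeRatio {A lam : ℝ} (hA : 0 < A) (h : lam ∈ sigmaDot A) :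
    ‖gaugeRatio A lam‖ = 1 := by
  rw [gaugeRatio, norm_div, norm_one_sub_phaseRate hA h, ← Complex.ofReal_mul, Complex.norm_real,
    Real.norm_eq_abs]
  exact div_self (abs_ne_zero.2 (mul_ne_zero (ne_zero_of_mem_sigmaDot hA h) hA.ne'))

theorem im_gaugeRatio {A lam : ℝ} (hA : 0 < A) (h : lam ∈ sigmaDot A) :
    (gaugeRatio A lam).im = (phaseRate A lam).im / (lam * A) := by
  have conj_eq : conj (gaugeRatio A lam) = (1 - phaseRate A lam) / (lam * A : ℝ) := by
    rw [← Complex.inv_eq_conj (norm_gaugeRatio hA h), gaugeRatio, inv_div, Complex.ofReal_mul]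
  have := congrArg Complex.im conj_eq
  rw [Complex.conj_im, Complex.div_ofReal_im, Complex.sub_im, Complex.one_im, zero_sub,
    neg_div] at this
  exact neg_inj.1 this

theorem norm_gaugeScale_sq {A lam : ℝ} (hA : 0 < A) (h : lam ∈ sigmaDot A) :
    ‖gaugeScale A lam‖ ^ 2 = lam * A / (2 * (phaseRate A lam).im) := by
  obtain ⟨κ, hκ, hpos⟩ := exists_phaseRate_eq_of_mem_sigmaDot hA h
  have hκ₀ : κ ≠ 0 := left_ne_zero_of_mul hpos.ne'
  have ratio_pos : 0 < lam * A / κ := by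
    rw [show lam * A / κ = κ * lam * A / κ ^ 2 by field_simp]
    positivity
  have hrate : phaseRate A lam ≠ 0 := by simp [hκ, hκ₀]
  have norm_rate : ‖phaseRate A lam‖ = |κ| := by simp [hκ]
  calc ‖gaugeScale A lam‖ ^ 2
      = ‖1 - phaseRate A lam‖ / ‖phaseRate A lam‖ / 2 := by
        rw [← norm_pow, gaugeScale_sq, div_sub_one hrate, norm_div, norm_div, RCLike.norm_ofNat]
    _ = lam * A / κ / 2 := by
        rw [norm_one_sub_phaseRate hA h, norm_rate, ← abs_div, abs_of_pos ratio_pos]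
    _ = lam * A / (2 * (phaseRate A lam).im) := by
        simp [hκ, div_div, mul_comm κ]

/-- The quantity `2 Im (v₀ v̄₁)`, which is conserved along solutions of the `x`-equation with
real spectral parameter. -/
def flux (v : Fin 2 → ℂ) : ℝ := 2 * (v 0 * conj (v 1)).im

theorem flux_zero : flux 0 = 0 := by simp [flux]

theorem continuous_flux : Continuous flux := by
  unfold flux
  fun_prop

theorem norm_sq_sub_norm_sq_of_norm_eq_one {α : ℂ} (hα : ‖α‖ = 1) (v : Fin 2 → ℂ) :
    ‖α * v 0 - v 1‖ ^ 2 - ‖α * v 1 - v 0‖ ^ 2 = 2 * α.im * flux v := by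
  have hα_sq : α.re ^ 2 + α.im ^ 2 = 1 := by
    rw [sq, sq, ← Complex.normSq_apply, Complex.normSq_eq_norm_sq, hα, one_pow]
  simp only [flux, Complex.sq_norm, Complex.normSq_apply, Complex.sub_re, Complex.sub_im,
    Complex.mul_re, Complex.mul_im, Complex.conj_re, Complex.conj_im]
  linear_combination ((v 0).re ^ 2 + (v 0).im ^ 2 - (v 1).re ^ 2 - (v 1).im ^ 2) * hα_sq

theorem gaugeH_mulVec (A : ℝ) (z : ℂ) (v : Fin 2 → ℂ) :
    gaugeH A z *ᵥ v =
      gaugeScale A z • ![gaugeRatio A z * v 0 - v 1, gaugeRatio A z * v 1 - v 0] := by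
  rw [gaugeH_eq, Matrix.smul_mulVec]
  congr 1
  ext i
  fin_cases i
  · simp [dotProduct, Fin.sum_univ_two, sub_eq_add_neg]
  · simp [dotProduct, Fin.sum_univ_two, sub_eq_neg_add]

theorem norm_gaugeH_mulVec_sq_sub_sq {A lam : ℝ} (hA : 0 < A) (h : lam ∈ sigmaDot A)
    (v : Fin 2 → ℂ) :
    ‖(gaugeH A lam *ᵥ v) 0‖ ^ 2 - ‖(gaugeH A lam *ᵥ v) 1‖ ^ 2 = flux v := by
  have scale_mul_im : ‖gaugeScale A lam‖ ^ 2 * (gaugeRatio A lam).im = 1 / 2 := by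
    obtain ⟨κ, hκ, hpos⟩ := exists_phaseRate_eq_of_mem_sigmaDot hA h
    have hκ₀ : (phaseRate A lam).im ≠ 0 := by simpa [hκ] using left_ne_zero_of_mul hpos.ne'
    have := ne_zero_of_mem_sigmaDot hA h
    rw [norm_gaugeScale_sq hA h, im_gaugeRatio hA h]
    field_simp
  simp only [gaugeH_mulVec, Pi.smul_apply, smul_eq_mul, norm_mul, mul_pow, Matrix.cons_val_zero,
    Matrix.cons_val_one]
  rw [← mul_sub, norm_sq_sub_norm_sq_of_norm_eq_one (norm_gaugeRatio hA h)]
  linear_combination 2 * flux v * scale_mul_im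

theorem IsLaxSolution.flux_eq {m₀ : ℝ → ℝ} {lam : ℝ} {ψ : ℝ → Fin 2 → ℂ}
    (h : IsLaxSolution m₀ lam ψ) (x x' : ℝ) : flux (ψ x) = flux (ψ x') := by
  have deriv_zero (x : ℝ) : HasDerivAt (fun x => flux (ψ x)) 0 x := by
    have hψ := hasDerivAt_pi.1 (h x)
    have := (Complex.imCLM.hasFDerivAt.comp_hasDerivAt x ((hψ 0).mul (hψ 1).star)).const_mul 2
    refine this.congr_deriv ?_
    simp [laxU, Matrix.mulVec, dotProduct, Fin.sum_univ_two]
    ring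
  exact is_const_of_deriv_eq_zero (fun x => (deriv_zero x).differentiableAt)
    (fun x => (deriv_zero x).deriv) x x'

theorem tendsto_norm_add {α E : Type*} [SeminormedAddCommGroup E] {l : Filter α} {f g : α → E}
    {c : ℝ} (hf : Tendsto (fun x => ‖f x‖) l (𝓝 c)) (hg : Tendsto g l (𝓝 0)) :
    Tendsto (fun x => ‖f x + g x‖) l (𝓝 c) := by
  refine hf.congr_dist (squeeze_zero (fun _ => dist_nonneg) (fun x => ?_)
    (tendsto_zero_iff_norm_tendsto_zero.1 hg))
  simpa [Real.dist_eq] using abs_norm_sub_norm_le (f x) (f x + g x)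

theorem tendsto_norm_apply_of_tendsto_exp_smul {α ι : Type*} {l : Filter α} {θ : α → ℂ}
    (hθ : ∀ x, (θ x).re = 0) {w : α → ι → ℂ} {p : ι → ℂ}
    (h : Tendsto (fun x => Complex.exp (θ x) • w x) l (𝓝 p)) (i : ι) :
    Tendsto (fun x => ‖w x i‖) l (𝓝 ‖p i‖) := by
  simpa [Complex.norm_exp, hθ] using (tendsto_pi_nhds.1 h i).norm

theorem flux_eq_of_isJostRight {A lam : ℝ} (hA : 0 < A) (h : lam ∈ sigmaDot A) {m₀ : ℝ → ℝ}
    {ψ φ₁ φ₂ : ℝ → Fin 2 → ℂ} {c₁ c₂ : ℂ} (hψ : IsLaxSolution m₀ lam ψ)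
    (h₁ : IsJostRightFst A m₀ lam φ₁) (h₂ : IsJostRightSnd A m₀ lam φ₂)
    (hc : ∀ x, ψ x = c₁ • φ₁ x + c₂ • φ₂ x) (x : ℝ) :
    flux (ψ x) = ‖c₁‖ ^ 2 - ‖c₂‖ ^ 2 := by
  have w₁_lim := tendsto_norm_apply_of_tendsto_exp_smul (phaseRight_re_eq_zero hA h m₀) h₁.2
  have w₂_lim := tendsto_norm_apply_of_tendsto_exp_smul
    (fun x => by rw [Complex.neg_re, phaseRight_re_eq_zero hA h m₀, neg_zero]) h₂.2
  have gauge_comb (i : Fin 2) (x : ℝ) : (gaugeH A lam *ᵥ ψ x) i =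
      c₁ * (gaugeH A lam *ᵥ φ₁ x) i + c₂ * (gaugeH A lam *ᵥ φ₂ x) i := by
    rw [hc, Matrix.mulVec_add, Matrix.mulVec_smul, Matrix.mulVec_smul]
    rfl
  have fst_lim : Tendsto (fun x => ‖(gaugeH A lam *ᵥ ψ x) 0‖) atTop (𝓝 ‖c₁‖) := by
    simp only [gauge_comb]
    refine tendsto_norm_add ?_ ?_
    · simpa using (w₁_lim 0).const_mul ‖c₁‖
    · simpa using (tendsto_zero_iff_norm_tendsto_zero.2 (by simpa using w₂_lim 0)).const_mul c₂
  have snd_lim : Tendsto (fun x => ‖(gaugeH A lam *ᵥ ψ x) 1‖) atTop (𝓝 ‖c₂‖) := by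
    simp only [gauge_comb, add_comm (c₁ * _)]
    refine tendsto_norm_add ?_ ?_
    · simpa using (w₂_lim 1).const_mul ‖c₂‖
    · simpa using (tendsto_zero_iff_norm_tendsto_zero.2 (by simpa using w₁_lim 1)).const_mul c₁
  refine tendsto_nhds_unique (tendsto_const_nhds.congr fun x' => ?_)
    ((fst_lim.pow 2).sub (snd_lim.pow 2))
  rw [norm_gaugeH_mulVec_sq_sub_sq hA h, hψ.flux_eq x x']

theorem tendsto_exp_neg_phaseLeft {A lam : ℝ} (hA : 0 < A) (h : lam ∈ gammaDot A)
    (m₀ : ℝ → ℝ) :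
    Tendsto (fun x => Complex.exp (-phaseLeft A m₀ x lam)) atBot (𝓝 0) := by
  obtain ⟨κ, hκ, hrate⟩ := exists_phaseRate_eq_of_mem_gammaDot hA h
  have length_lim : Tendsto (fun x => 1 / (2 * A) * (∫ ξ in Set.Iic x, (m₀ ξ - A)) + x / 2)
      atBot atBot :=
    ((tendsto_integral_Iic_zero tendsto_id).const_mul _).add_atBot
      (tendsto_id.atBot_div_const two_pos)
  rw [Complex.tendsto_exp_nhds_zero_iff]
  refine (length_lim.const_mul_atBot (neg_pos.2 hκ)).congr fun x => ?_
  rw [Complex.neg_re, phaseLeft, ← phaseRate, hrate, Complex.re_mul_ofReal, Complex.ofReal_re,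
    neg_mul]

namespace IsJostLeftFst

variable {A lam : ℝ} {m₀ : ℝ → ℝ} {ψ : ℝ → Fin 2 → ℂ}

theorem ne_zero {z : ℂ} (hψ : IsJostLeftFst A m₀ z ψ) : ψ ≠ 0 := by
  rintro rfl
  have := hψ.2
  simp only [Pi.zero_apply, Matrix.mulVec_zero, smul_zero] at this
  simpa using congrFun (tendsto_nhds_unique tendsto_const_nhds this) 0

theorem flux_eq_one (hA : 0 < A) (h : lam ∈ sigmaDot A) (hψ : IsJostLeftFst A m₀ lam ψ) (x : ℝ) :
    flux (ψ x) = 1 := by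
  have w_lim := tendsto_norm_apply_of_tendsto_exp_smul (phaseLeft_re_eq_zero hA h m₀) hψ.2
  have := ((w_lim 0).pow 2).sub ((w_lim 1).pow 2)
  simp only [norm_gaugeH_mulVec_sq_sub_sq hA h, hψ.1.flux_eq _ x] at this
  simpa using tendsto_nhds_unique tendsto_const_nhds this

theorem tendsto_zero (hA : 0 < A) (h : lam ∈ gammaDot A) (hψ : IsJostLeftFst A m₀ lam ψ) :
    Tendsto ψ atBot (𝓝 0) := by
  have det_isUnit : IsUnit (gaugeH A lam).det := by
    obtain ⟨κ, hκ, hrate⟩ := exists_phaseRate_eq_of_mem_gammaDot hA h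
    rw [det_gaugeH hA.ne' (by rw [hrate]; exact_mod_cast hκ.ne)
      (by rw [hrate]; exact_mod_cast (hκ.trans one_pos).ne)]
    exact isUnit_one
  have gauge_lim : Tendsto (fun x => gaugeH A lam *ᵥ ψ x) atBot (𝓝 0) := by
    have := (tendsto_exp_neg_phaseLeft hA h m₀).smul hψ.2
    simpa only [smul_smul, ← Complex.exp_add, neg_add_cancel, Complex.exp_zero, one_smul,
      zero_smul] using this
  have inv_cont : Continuous fun v : Fin 2 → ℂ => (gaugeH A lam)⁻¹ *ᵥ v := by fun_prop
  simpa only [Function.comp_def, Matrix.mulVec_mulVec, Matrix.nonsing_inv_mul _ det_isUnit,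
    Matrix.one_mulVec, Matrix.mulVec_zero] using (inv_cont.tendsto 0).comp gauge_lim

theorem flux_eq_zero (hA : 0 < A) (h : lam ∈ gammaDot A) (hψ : IsJostLeftFst A m₀ lam ψ) (x : ℝ) :
    flux (ψ x) = 0 := by
  have := (continuous_flux.tendsto 0).comp (hψ.tendsto_zero hA h)
  rw [flux_zero] at this
  exact tendsto_nhds_unique (tendsto_const_nhds.congr fun x' => hψ.1.flux_eq x x') this

end IsJostLeftFst

theorem sigmaDot_mono {A₁ A₂ : ℝ} (hA₁ : 0 < A₁) (hA : A₁ ≤ A₂) : sigmaDot A₁ ⊆ sigmaDot A₂ :=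
  fun _ h => (one_div_le_one_div_of_le hA₁ hA).trans_lt h

namespace IsReflectionCoefficient

variable {A₁ A₂ lam : ℝ} {u₀ : ℝ → ℝ} {r : ℝ → ℂ}

theorem norm_lt_one (hA₁ : 0 < A₁) (hA : A₁ ≤ A₂) (hr : IsReflectionCoefficient A₁ A₂ u₀ r)
    (h : lam ∈ sigmaDot A₁) : ‖r lam‖ < 1 := by
  obtain ⟨ψ, φ₁, φ₂, c₁, c₂, hψ, h₁, h₂, hc, hr_eq⟩ := hr lam (Or.inl h)
  have hflux : 1 = ‖c₁‖ ^ 2 - ‖c₂‖ ^ 2 := by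
    rw [← hψ.flux_eq_one hA₁ h 0,
      flux_eq_of_isJostRight (hA₁.trans_le hA) (sigmaDot_mono hA₁ hA h) hψ.1 h₁ h₂ hc]
  have hlt : ‖c₂‖ < ‖c₁‖ := lt_of_pow_lt_pow_left₀ 2 (norm_nonneg _) (by linarith)
  rwa [hr_eq, norm_div, div_lt_one ((norm_nonneg _).trans_lt hlt)]

theorem norm_eq_one (hA₁ : 0 < A₁) (hA₂ : 0 < A₂) (hr : IsReflectionCoefficient A₁ A₂ u₀ r)
    (h : lam ∈ sigmaZeroDot A₁ A₂) : ‖r lam‖ = 1 := by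
  obtain ⟨ψ, φ₁, φ₂, c₁, c₂, hψ, h₁, h₂, hc, hr_eq⟩ := hr lam (Or.inr h)
  have hflux : ‖c₁‖ ^ 2 - ‖c₂‖ ^ 2 = 0 := by
    rw [← flux_eq_of_isJostRight hA₂ h.1 hψ.1 h₁ h₂ hc 0, hψ.flux_eq_zero hA₁ h.2]
  have norm_eq : ‖c₂‖ = ‖c₁‖ :=
    ((sq_eq_sq₀ (norm_nonneg _) (norm_nonneg _)).1 (sub_eq_zero.1 hflux)).symm
  have hc₁ : ‖c₁‖ ≠ 0 := by
    intro hc₁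
    rw [hc₁] at norm_eq
    refine hψ.ne_zero (funext fun x => ?_)
    simp [hc, norm_eq_zero.1 hc₁, norm_eq_zero.1 norm_eq]
  rw [hr_eq, norm_div, norm_eq, div_self hc₁]

end IsReflectionCoefficient

section JumpMatrix

variable {A₁ A₂ lam : ℝ} {r : ℝ → ℂ}

theorem phaseHat_re_eq_zero {A lam : ℝ} (hA : 0 < A) (h : lam ∈ sigmaDot A) (y t : ℝ) :
    (phaseHat A y t lam).re = 0 := by
  rw [phaseHat, ← phaseRate, div_mul_eq_mul_div, Complex.div_ofNat_re,
    show (y - 2 * t / (lam : ℂ) ^ 2 : ℂ) = (y - 2 * t / lam ^ 2 : ℝ) by push_cast; rfl,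
    Complex.re_mul_ofReal, phaseRate_re_eq_zero hA h, zero_mul, zero_div]

theorem jumpCore_add_conjTranspose_of_mem_sigmaDot (h : lam ∈ sigmaDot A₁) :
    jumpCore A₁ r lam + (jumpCore A₁ r lam)ᴴ =
      Matrix.diagonal ![2 * (1 - (‖r lam‖ ^ 2 : ℝ) : ℂ), 2] := by
  rw [jumpCore, if_pos h]
  ext i j
  fin_cases i <;> fin_cases j
  · simp
    ring
  all_goals norm_num

theorem jumpCore_add_conjTranspose_of_mem_sigmaZeroDot (h : lam ∈ sigmaZeroDot A₁ A₂)
    (hr : ‖r lam‖ = 1) :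
    jumpCore A₁ r lam + (jumpCore A₁ r lam)ᴴ = Matrix.diagonal ![0, 2] := by
  rw [jumpCore, if_neg (fun h' : lam ∈ sigmaDot A₁ => lt_asymm h' h.2), one_div,
    Complex.inv_eq_conj hr]
  ext i j
  fin_cases i <;> fin_cases j <;> norm_num

theorem jumpMatrix_add_conjTranspose_of_mem_gammaDot (h : lam ∈ gammaDot A₂) (y t : ℝ) :
    jumpMatrix A₁ A₂ r y t lam + (jumpMatrix A₁ A₂ r y t lam)ᴴ = 0 := by
  rw [jumpMatrix, if_pos h]
  ext i j
  fin_cases i <;> fin_cases j <;> simp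

theorem exists_isUnit_jumpMatrix_add_conjTranspose_eq (hA₂ : 0 < A₂) (h : lam ∈ sigmaDot A₂)
    (y t : ℝ) : ∃ D : Matrix (Fin 2) (Fin 2) ℂ, IsUnit D ∧
      jumpMatrix A₁ A₂ r y t lam + (jumpMatrix A₁ A₂ r y t lam)ᴴ =
        Dᴴ * (jumpCore A₁ r lam + (jumpCore A₁ r lam)ᴴ) * D := by
  set θ := phaseHat A₂ y t lam with hθ
  have conj_θ : conj θ = -θ := by
    apply Complex.ext <;> simp [hθ, phaseHat_re_eq_zero hA₂ h]
  set D : Matrix (Fin 2) (Fin 2) ℂ := !![Complex.exp θ, 0; 0, Complex.exp (-θ)] with hD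
  have conjTranspose_D : Dᴴ = !![Complex.exp (-θ), 0; 0, Complex.exp θ] := by
    ext i j
    fin_cases i <;> fin_cases j <;> simp [hD, ← Complex.exp_conj, conj_θ]
  have jump_eq : jumpMatrix A₁ A₂ r y t lam = Dᴴ * jumpCore A₁ r lam * D := by
    have h_notMem : lam ∉ gammaDot A₂ := not_lt_of_gt (show 1 / A₂ < |lam| from h)
    rw [jumpMatrix, if_neg h_notMem, conjTranspose_D]
  refine ⟨D, ?_, ?_⟩
  · rw [Matrix.isUnit_iff_isUnit_det, hD, Matrix.det_fin_two_of, ← Complex.exp_add]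
    simp
  · rw [jump_eq, Matrix.conjTranspose_mul, Matrix.conjTranspose_mul,
      Matrix.conjTranspose_conjTranspose, Matrix.mul_add, Matrix.add_mul, Matrix.mul_assoc Dᴴ _ D,
      Matrix.mul_assoc Dᴴ _ D]

theorem jumpMatrix_add_conjTranspose_posDef (hA₁ : 0 < A₁) (hA : A₁ ≤ A₂)
    (h : lam ∈ sigmaDot A₁) (hr : ‖r lam‖ < 1) (y t : ℝ) :
    (jumpMatrix A₁ A₂ r y t lam + (jumpMatrix A₁ A₂ r y t lam)ᴴ).PosDef := by
  obtain ⟨D, hD, hjump⟩ := exists_isUnit_jumpMatrix_add_conjTranspose_eq (A₁ := A₁) (r := r)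
    (hA₁.trans_le hA) (sigmaDot_mono hA₁ hA h) y t
  have norm_sq_lt : ‖r lam‖ ^ 2 < 1 := pow_lt_one₀ (norm_nonneg _) hr two_ne_zero
  rw [hjump, jumpCore_add_conjTranspose_of_mem_sigmaDot h]
  refine (Matrix.PosDef.diagonal fun i => ?_).conjTranspose_mul_mul_same
    (Matrix.mulVec_injective_of_isUnit hD)
  fin_cases i
  · exact mul_pos two_pos (by exact_mod_cast sub_pos.2 norm_sq_lt)
  · exact two_pos

theorem jumpMatrix_add_conjTranspose_posSemidef_of_mem_sigmaZeroDot (hA₂ : 0 < A₂)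
    (h : lam ∈ sigmaZeroDot A₁ A₂) (hr : ‖r lam‖ = 1) (y t : ℝ) :
    (jumpMatrix A₁ A₂ r y t lam + (jumpMatrix A₁ A₂ r y t lam)ᴴ).PosSemidef := by
  obtain ⟨D, -, hjump⟩ :=
    exists_isUnit_jumpMatrix_add_conjTranspose_eq (A₁ := A₁) (r := r) hA₂ h.1 y t
  rw [hjump, jumpCore_add_conjTranspose_of_mem_sigmaZeroDot h hr]
  refine (Matrix.PosSemidef.diagonal fun i => ?_).conjTranspose_mul_mul_same D
  fin_cases i
  · exact le_rfl
  · exact zero_le_two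

theorem mem_gammaDot_or_mem_sigmaZeroDot_or_mem_sigmaDot (hA₁ : 0 ≤ A₁) (hA₂ : 0 ≤ A₂)
    (h : lam ∉ branchPoints A₁ A₂) :
    lam ∈ gammaDot A₂ ∨ lam ∈ sigmaZeroDot A₁ A₂ ∨ lam ∈ sigmaDot A₁ := by
  simp only [branchPoints, Set.mem_insert_iff, Set.mem_singleton_iff, not_or] at h
  have hne₁ : |lam| ≠ 1 / A₁ := by rw [Ne, abs_eq (by positivity)]; tauto
  have hne₂ : |lam| ≠ 1 / A₂ := by rw [Ne, abs_eq (by positivity)]; tauto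
  rcases hne₂.lt_or_gt with h₂ | h₂
  · exact Or.inl h₂
  · exact Or.inr (hne₁.lt_or_gt.imp (fun h₁ => ⟨h₂, h₁⟩) id)

theorem jumpMatrix_add_conjTranspose_posSemidef (hA₁ : 0 < A₁) (hA : A₁ ≤ A₂)
    (hr₁ : ∀ lam ∈ sigmaDot A₁, ‖r lam‖ < 1) (hr₀ : ∀ lam ∈ sigmaZeroDot A₁ A₂, ‖r lam‖ = 1)
    (h : lam ∉ branchPoints A₁ A₂) (y t : ℝ) :
    (jumpMatrix A₁ A₂ r y t lam + (jumpMatrix A₁ A₂ r y t lam)ᴴ).PosSemidef := by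
  have hA₂ := hA₁.trans_le hA
  rcases mem_gammaDot_or_mem_sigmaZeroDot_or_mem_sigmaDot hA₁.le hA₂.le h with h | h | h
  · exact jumpMatrix_add_conjTranspose_of_mem_gammaDot h y t ▸ Matrix.PosSemidef.zero
  · exact jumpMatrix_add_conjTranspose_posSemidef_of_mem_sigmaZeroDot hA₂ h (hr₀ lam h) y t
  · exact (jumpMatrix_add_conjTranspose_posDef hA₁ hA h (hr₁ lam h) y t).posSemidef

theorem notMem_branchPoints_of_mem_sigmaDot (hA₁ : 0 < A₁) (hA : A₁ ≤ A₂) (h : lam ∈ sigmaDot A₁) :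
    lam ∉ branchPoints A₁ A₂ := by
  have h₁ : 1 / A₁ < |lam| := h
  have h₂ : 1 / A₂ < |lam| := sigmaDot_mono hA₁ hA h
  have hA₁_inv : 0 < 1 / A₁ := by positivity
  have hA₂_inv : 0 < 1 / A₂ := one_div_pos.2 (hA₁.trans_le hA)
  rintro (rfl | rfl | rfl | rfl)
  · exact h₁.ne' (abs_of_pos hA₁_inv)
  · exact h₁.ne' (by rw [abs_neg, abs_of_pos hA₁_inv])
  · exact h₂.ne' (abs_of_pos hA₂_inv)
  · exact h₂.ne' (by rw [abs_neg, abs_of_pos hA₂_inv])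

end JumpMatrix

theorem tendsto_conj_nhdsWithin (x : ℝ) :
    Tendsto conj (𝓝[ℍₒ] (x : ℂ)) (𝓝[{z : ℂ | z.im < 0}] (x : ℂ)) := by
  refine tendsto_nhdsWithin_iff.2 ⟨?_, ?_⟩
  · simpa using (Complex.continuous_conj.tendsto (x : ℂ)).mono_left nhdsWithin_le_nhds
  · filter_upwards [self_mem_nhdsWithin] with z hz
    simpa using hz

theorem upperHalfPlaneSet_subset_offReal : ℍₒ ⊆ offReal := fun _ hz => ne_of_gt hz

theorem tendsto_conj_cobounded :
    Tendsto conj (Bornology.cobounded ℂ ⊓ 𝓟 ℍₒ) (Bornology.cobounded ℂ ⊓ 𝓟 offReal) := by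
  refine Tendsto.inf ?_ (tendsto_principal_principal.2 fun z hz => ?_)
  · simpa [← tendsto_norm_atTop_iff_cobounded] using tendsto_norm_cobounded_atTop
  · simpa [offReal] using upperHalfPlaneSet_subset_offReal hz

theorem isLittleO_inv_rpow_cobounded :
    (fun z : ℂ => z⁻¹) =o[Bornology.cobounded ℂ] fun z => ‖z‖ ^ (-(1 / 2) : ℝ) := by
  have lim : Tendsto (fun z : ℂ => ‖z‖ ^ (-(1 / 2) : ℝ)) (Bornology.cobounded ℂ) (𝓝 0) :=
    (tendsto_rpow_neg_atTop one_half_pos).comp tendsto_norm_cobounded_atTop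
  refine IsLittleO.of_norm_left ?_
  simpa only [norm_inv, ← rpow_neg_half_mul_self (norm_nonneg _), one_mul] using
    ((isLittleO_one_iff ℝ).2 lim).mul_isBigO (isBigO_refl (fun z : ℂ => ‖z‖ ^ (-(1 / 2) : ℝ)) _)

/-- The Schwarz reflection of a vector-valued function in the real line. -/
def schwarzReflection {ι : Type*} (u : ℂ → ι → ℂ) (z : ℂ) : ι → ℂ := star (u (conj z))

theorem differentiableOn_schwarzReflection {ι : Type*} [Finite ι] {u : ℂ → ι → ℂ}
    (hu : DifferentiableOn ℂ u offReal) : DifferentiableOn ℂ (schwarzReflection u) ℍₒ := by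
  have := Fintype.ofFinite ι
  have isOpen_offReal : IsOpen offReal := isOpen_ne_fun Complex.continuous_im continuous_const
  refine differentiableOn_pi.2 fun i z hz => DifferentiableAt.differentiableWithinAt ?_
  have conj_mem : conj z ∈ offReal := by
    simpa [offReal] using upperHalfPlaneSet_subset_offReal hz
  have := (differentiableOn_pi.1 hu i).differentiableAt (isOpen_offReal.mem_nhds conj_mem)
  rw [← Complex.conj_conj z]
  exact this.conj_conj

namespace IsHomogeneousSolution

variable {A₁ A₂ y t : ℝ} {r : ℝ → ℂ} {m : ℂ → Matrix (Fin 2) (Fin 2) ℂ}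

theorem differentiableOn_row (hm : IsHomogeneousSolution A₁ A₂ r y t m) (i : Fin 2) :
    DifferentiableOn ℂ (fun z => m z i) offReal :=
  differentiableOn_pi.2 (hm.analytic i)

theorem isLittleO_row (hm : IsHomogeneousSolution A₁ A₂ r y t m) (i : Fin 2) :
    (fun z => m z i) =o[Bornology.cobounded ℂ ⊓ 𝓟 offReal] fun z => ‖z‖ ^ (-(1 / 2) : ℝ) :=
  isLittleO_pi.2 fun j => (hm.decay i j).trans_isLittleO
    (isLittleO_inv_rpow_cobounded.mono inf_le_left)

theorem isLittleO_schwarzReflection_row (hm : IsHomogeneousSolution A₁ A₂ r y t m) (i : Fin 2) :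
    schwarzReflection (fun z => m z i) =o[Bornology.cobounded ℂ ⊓ 𝓟 ℍₒ]
      fun z => ‖z‖ ^ (-(1 / 2) : ℝ) := by
  refine .of_norm_left ?_
  simpa [Function.comp_def, schwarzReflection] using
    ((hm.isLittleO_row i).comp_tendsto tendsto_conj_cobounded).norm_left

theorem hasBoundaryValues_row (hm : IsHomogeneousSolution A₁ A₂ r y t m) {S : Finset ℝ}
    (hS : (S : Set ℝ) = branchPoints A₁ A₂) {P : ℝ → Matrix (Fin 2) (Fin 2) ℂ}
    (hP : ∀ x ∉ S, Tendsto m (𝓝[ℍₒ] (x : ℂ)) (𝓝 (P x))) (i : Fin 2) :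
    HasBoundaryValues S (1 / 4) (fun z => m z i) fun x => P x i where
  continuousOn := (hm.differentiableOn_row i).continuousOn.mono upperHalfPlaneSet_subset_offReal
  tendsto x hx := tendsto_pi_nhds.1 (hP x hx) i
  isBigO s hs := isBigO_pi.2 fun j => (hm.singularity s (hS ▸ hs) i j).mono
    (nhdsWithin_mono _ upperHalfPlaneSet_subset_offReal)

theorem hasBoundaryValues_schwarzReflection_row (hm : IsHomogeneousSolution A₁ A₂ r y t m)
    {S : Finset ℝ} (hS : (S : Set ℝ) = branchPoints A₁ A₂) {M : ℝ → Matrix (Fin 2) (Fin 2) ℂ}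
    (hM : ∀ x ∉ S, Tendsto m (𝓝[{z : ℂ | z.im < 0}] (x : ℂ)) (𝓝 (M x))) (i : Fin 2) :
    HasBoundaryValues S (1 / 4) (schwarzReflection fun z => m z i) fun x => star (M x i) where
  continuousOn := (differentiableOn_schwarzReflection (hm.differentiableOn_row i)).continuousOn
  tendsto x hx := ((tendsto_pi_nhds.1 (hM x hx) i).comp (tendsto_conj_nhdsWithin x)).star
  isBigO s hs := by
    have conj_lim := (tendsto_conj_nhdsWithin s).mono_right
      (nhdsWithin_mono _ fun z (hz : z.im < 0) => (hz.ne : z ∈ offReal))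
    have norm_conj_sub (z : ℂ) : ‖conj z - s‖ = ‖z - s‖ := by
      rw [← RCLike.norm_conj, map_sub, Complex.conj_conj, Complex.conj_ofReal]
    refine .of_norm_left ?_
    simpa [Function.comp_def, norm_conj_sub, schwarzReflection] using
      ((isBigO_pi.2 fun j => hm.singularity s (hS ▸ hs) i j).comp_tendsto conj_lim).norm_left

end IsHomogeneousSolution

end StepMCH

open StepMCH Topology Filter ComplexConjugate in
theorem mainTheorem4_general {A₁ A₂ : ℝ} (hA₁ : 0 < A₁) (hA : A₁ ≤ A₂) {r : ℝ → ℂ}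
    (hr₁ : ∀ lam ∈ sigmaDot A₁, ‖r lam‖ < 1) (hr₀ : ∀ lam ∈ sigmaZeroDot A₁ A₂, ‖r lam‖ = 1)
    {y t : ℝ} {m : ℂ → Matrix (Fin 2) (Fin 2) ℂ} (hm : IsHomogeneousSolution A₁ A₂ r y t m) :
    ∀ z : ℂ, z.im ≠ 0 → m z = 0 := by
  obtain ⟨S, hS⟩ : ∃ S : Finset ℝ, (S : Set ℝ) = branchPoints A₁ A₂ :=
    ⟨{1 / A₁, -(1 / A₁), 1 / A₂, -(1 / A₂)}, by simp [branchPoints]⟩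
  have mem_S (x : ℝ) : x ∈ S ↔ x ∈ branchPoints A₁ A₂ := by rw [← hS, Finset.mem_coe]
  have jump := hm.jump
  simp only [← mem_S] at jump
  choose! P M hP hM hPM using jump
  have row_eq_zero (i : Fin 2) := by
    refine eqOn_zero_of_jump (G := jumpMatrix A₁ A₂ r y t) (x₀ := 1 / A₁ + 1) (by norm_num)
      (by norm_num) (hm.hasBoundaryValues_row hS hP i)
      (hm.hasBoundaryValues_schwarzReflection_row hS hM i)
      ((hm.differentiableOn_row i).mono upperHalfPlaneSet_subset_offReal)
      (differentiableOn_schwarzReflection (hm.differentiableOn_row i))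
      ((hm.isLittleO_row i).mono (by gcongr; exact upperHalfPlaneSet_subset_offReal))
      (hm.isLittleO_schwarzReflection_row i) (fun x hx => ?_) (fun x hx => ?_) ?_
    · rw [hPM x hx, star_star]
      rfl
    · exact jumpMatrix_add_conjTranspose_posSemidef hA₁ hA hr₁ hr₀ (mt (mem_S x).2 hx) y t
    · filter_upwards [lt_mem_nhds (lt_add_one (1 / A₁))] with x hx
      have hx : x ∈ sigmaDot A₁ := hx.trans_le (le_abs_self x)
      exact ⟨mt (mem_S x).1 (notMem_branchPoints_of_mem_sigmaDot hA₁ hA hx),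
        jumpMatrix_add_conjTranspose_posDef hA₁ hA hx (hr₁ x hx) y t⟩
  intro z hz
  refine funext fun i => show m z i = 0 from ?_
  rcases hz.lt_or_gt with hz | hz
  · simpa [schwarzReflection] using (row_eq_zero i).2 (show 0 < (conj z).im by simpa using hz)
  · exact (row_eq_zero i).1 hz

theorem mainTheorem4 (A₁ A₂ : ℝ) (hA₁ : 0 < A₁) (hA₁₂ : A₁ < A₂)
    (u₀ : ℝ → ℝ) (hu₀ : StepMCH.IsStepLike A₁ A₂ u₀)
    (r : ℝ → ℂ) (hr : StepMCH.IsReflectionCoefficient A₁ A₂ u₀ r)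
    (y t : ℝ) (ht : 0 < t)
    (m : ℂ → Matrix (Fin 2) (Fin 2) ℂ)
    (hm : StepMCH.IsHomogeneousSolution A₁ A₂ r y t m) :
    ∀ z : ℂ, z.im ≠ 0 → m z = 0 :=
  mainTheorem4_general hA₁ hA₁₂.le (fun _ h => hr.norm_lt_one hA₁ hA₁₂.le h)
    (fun _ h => hr.norm_eq_one hA₁ (hA₁.trans hA₁₂) h) hm
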